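/- Let $n, n_1$ be integers with $1 < n_1 < n-1$, let $a_1,\dots,a_n \in (-1,1)$, $\vec a_1=(a_1,\dots,a_{n_1})'$, $\vec a_2=(a_{n_1+1},\dots,a_n)'$, let $|\vartheta|<1$, and let $$R_\vartheta = \mathrm{Diag}(1-a_1^2,\dots,1-a_n^2) + \begin{pmatrix} \vec a_1\vec a_1' & \vartheta\,\vec a_1\vec a_2' \\ \vartheta\,\vec a_2\vec a_1' & \vec a_2\vec a_2'\end{pmatrix}.$$ For every real $\alpha>0$ the $\Gamma_n(\alpha,R_\vartheta)$-distribution exists and is unique, i.e. there is exactly one probability measure on $\mathbb{R}^n$ that is concentrated on $[0,\infty)^n$ and has the Laplace transform $\det(I_n+R_\vartheta T)^{-\alpha}$, $T=\mathrm{Diag}(t_1,\dots,t_n)$, $t_i\ge 0$. Let $(X_1,\dots,X_n)$ have this distribution and let $F(x)=P(X_1\le x_1,\dots,X_n\le x_n)$ be its cdf. Then $F$ is MTP$_2$ on $(0,\infty)^n$, i.e. $F>0$ there and $$F(x\vee y)\,F(x\wedge y)\ \ge\ F(x)\,F(y)\qquad\text{for all } x,y\in(0,\infty)^n,$$ where $\vee$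 and $\wedge$ are the componentwise maximum and minimum. Moreover, for all $b\in(0,\infty)^n$, all $x\in\mathbb{R}^n$ with $x_i\le b_i$ for every $i$, and all $\emptyset\ne I\subseteq\{1,\dots,n\}$, the events $A_i=\{X_i\le x_i\}$ and $B_i=\{X_i\le b_i\}$ satisfy $$\frac{P(\bigcap_{i=1}^n A_i)}{P(\bigcap_{i=1}^n B_i)} \ \ge\ \frac{P(\bigcap_{i\in I} A_i)\,P(\bigcap_{i\notin I} A_i)}{P(\bigcap_{i\in I} B_i)\,P(\bigcap_{i\notin I} B_i)},$$ and, if all $x_i>0$, equivalently $$\frac{P(\bigcap_{i=1}^n A_i)}{P(\bigcap_{i\in I} A_i)\,P(\bigcap_{i\notin I} A_i)} \ \ge\ \frac{P(\bigcap_{i=1}^n B_i)}{P(\bigcap_{i\in I} B_i)\,P(\bigcap_{i\notin I} B_i)}.$$ (An empty intersection of events has probability $1$.) -/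

import Mathlib

open MeasureTheory

noncomputable section

/-- The block matrix `R_ϑ = D + (a₁a₁ᵀ, ϑ a₁a₂ᵀ; ϑ a₂a₁ᵀ, a₂a₂ᵀ)` with
`D = Diag(1 - a₁², …, 1 - aₙ²)`; the first block consists of the first `n₁` indices. -/
def blockFactorCorr {n : ℕ} (n₁ : ℕ) (a : Fin n → ℝ) (ϑ : ℝ) : Matrix (Fin n) (Fin n) ℝ :=
  Matrix.diagonal (fun i => 1 - a i ^ 2) +
    Matrix.of fun (i j : Fin n) =>
      (if ((i : ℕ) < n₁ ↔ (j : ℕ) < n₁) then 1 else ϑ) * (a i * a j)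

/-- `μ` is the `Γ_n(α, R)`-distribution (in the sense of Krishnamoorthy and Parthasarathy): a
probability measure on the nonnegative orthant with Laplace transform
`det(I + R T) ^ (-α)`, `T = Diag(t₁, …, tₙ)`, `t_i ≥ 0`. -/
structure IsMultivariateGamma {n : ℕ} (α : ℝ) (R : Matrix (Fin n) (Fin n) ℝ)
    (μ : Measure (Fin n → ℝ)) : Prop where
  isProbabilityMeasure : IsProbabilityMeasure μ
  ae_nonneg : ∀ᵐ x ∂μ, ∀ i, 0 ≤ x i
  laplace : ∀ t : Fin n → ℝ, (∀ i, 0 ≤ t i) →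
    ∫ x, Real.exp (-∑ i, t i * x i) ∂μ = (1 + R * Matrix.diagonal t).det ^ (-α)

/-- The joint cdf `F(x) = P(X₁ ≤ x₁, …, Xₙ ≤ xₙ)` of a distribution on `ℝⁿ`. -/
def jointCdf {n : ℕ} (μ : Measure (Fin n → ℝ)) (x : Fin n → ℝ) : ℝ :=
  μ.real {ω | ∀ i, ω i ≤ x i}

/-- `P(⋂_{i ∈ I} {X_i ≤ x_i})`. -/
def partialCdf {n : ℕ} (μ : Measure (Fin n → ℝ)) (I : Finset (Fin n)) (x : Fin n → ℝ) : ℝ :=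
  μ.real {ω | ∀ i ∈ I, ω i ≤ x i}

/-- `F` is multivariate totally positive of order 2 on `D`: it is everywhere positive on `D` and
`F(x ∨ y) F(x ∧ y) ≥ F(x) F(y)` for all `x, y ∈ D`, with componentwise maxima and minima.
(Used for `D` a product of intervals.) -/
def IsMTP2On {n : ℕ} (D : Set (Fin n → ℝ)) (F : (Fin n → ℝ) → ℝ) : Prop :=
  (∀ x ∈ D, 0 < F x) ∧ ∀ x ∈ D, ∀ y ∈ D, F x * F y ≤ F (x ⊔ y) * F (x ⊓ y)

end

open MeasureTheory

noncomputable section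

open ProbabilityTheory
open scoped ENNReal NNReal BoundedContinuousFunction

/-! The distribution is an explicit mixture of products of gamma distributions. Put `z i = 1 / (1 +
(1 - a i ^ 2) * t i)`, the Laplace transform of the exponential law of rate `1 / (1 - a i ^ 2)`. The
off-diagonal part of `R_ϑ` has rank-two structure, so the determinant equals `∏ (z i)⁻¹` times a
positive constant times `A * B - θ`, where `A` and `B` are one minus nonnegative linear forms in the
`z i` of each block and `θ ≥ 0`. Expanding `(A * B - θ) ^ (-α)` in powers of `θ` and then of `z`
gives nonnegative coefficients, indexed by `(k, N)` in `ℕ × ℕⁿ`; these are the weights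
(`exists_gammaMixture_laplace`). Uniqueness is injectivity of the Laplace transform on the orthant.
For MTP₂, the weights are log-supermodular in `(k, N)` (`mixWeight_mul_le`) because `Γ` is
log-convex, and a gamma cdf is totally positive of order 2 in shape and argument
(`gammaECDF_mul_le_inf_sup`). The four functions theorem on `ℕ × ℕⁿ` then sums out the index.
Allowing arguments `⊤` makes marginal cdfs values of the same function, and two uses of the MTP₂
inequality give the product inequality. -/

/-! ### Gamma integrals and negative multinomial series. -/

lemma ENNReal.tsum_pi_prod {n : ℕ} (f : Fin n → ℕ → ℝ≥0∞) :
    ∑' N : Fin n → ℕ, ∏ i, f i (N i) = ∏ i, ∑' m, f i m := by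
  induction n with
  | zero => simp [tsum_fintype]
  | succ n ih =>
    rw [← (Fin.consEquiv (fun _ : Fin (n + 1) => ℕ)).tsum_eq, ENNReal.tsum_prod', Fin.prod_univ_succ,
      ← ih, ← ENNReal.tsum_mul_right]
    refine tsum_congr fun m => ?_
    rw [← ENNReal.tsum_mul_left]
    refine tsum_congr fun N => ?_
    simp [Fin.consEquiv, Fin.prod_univ_succ]

lemma ENNReal.tsum_ofReal_pow_div_factorial {r : ℝ} (hr : 0 ≤ r) :
    ∑' m : ℕ, ENNReal.ofReal (r ^ m / m.factorial) = ENNReal.ofReal (Real.exp r) := by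
  have h := NormedSpace.expSeries_div_hasSum_exp (𝔸 := ℝ) r
  rw [← ENNReal.ofReal_tsum_of_nonneg (fun m => by positivity) h.summable, h.tsum_eq,
    Real.exp_eq_exp_ℝ]

lemma Real.integrableOn_rpow_mul_exp_neg_mul {a r : ℝ} (ha : 0 < a) (hr : 0 < r) :
    IntegrableOn (fun t : ℝ => t ^ (a - 1) * Real.exp (-(r * t))) (Set.Ioi 0) :=
  .of_integral_ne_zero (by
    rw [Real.integral_rpow_mul_exp_neg_mul_Ioi ha hr]
    have := Real.Gamma_pos_of_pos ha
    positivity)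

lemma lintegral_rpow_mul_exp_neg_mul {a r : ℝ} (ha : 0 < a) (hr : 0 < r) :
    ∫⁻ t in Set.Ioi (0 : ℝ), ENNReal.ofReal (t ^ (a - 1) * Real.exp (-(r * t))) =
      ENNReal.ofReal (r ^ (-a) * Real.Gamma a) := by
  rw [← ofReal_integral_eq_lintegral_ofReal (Real.integrableOn_rpow_mul_exp_neg_mul ha hr),
    Real.integral_rpow_mul_exp_neg_mul_Ioi ha hr, one_div, Real.inv_rpow hr.le, Real.rpow_neg hr.le]
  filter_upwards [ae_restrict_mem measurableSet_Ioi] with t ht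
  have : (0 : ℝ) < t := ht
  positivity

/-- `Γ(β + m)` as a mixed moment. -/
lemma ofReal_Gamma_add_natCast {β : ℝ} (hβ : 0 < β) (m : ℕ) :
    ENNReal.ofReal (Real.Gamma (β + m)) =
      ∫⁻ t in Set.Ioi (0 : ℝ), ENNReal.ofReal (t ^ (β - 1) * Real.exp (-t)) *
        ENNReal.ofReal (t ^ m) := by
  have h := lintegral_rpow_mul_exp_neg_mul (a := β + m) (r := 1) (by positivity) one_pos
  rw [Real.one_rpow, one_mul] at h
  rw [← h]
  refine setLIntegral_congr_fun measurableSet_Ioi fun t ht => ?_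
  have ht : (0 : ℝ) < t := ht
  simp only [one_mul]
  rw [← ENNReal.ofReal_mul (by positivity), show β + m - 1 = (β - 1) + m by ring,
    Real.rpow_add ht, Real.rpow_natCast]
  ring_nf

/-- Negative binomial series. -/
lemma tsum_Gamma_mul_pow_div_factorial {β r : ℝ} (hβ : 0 < β) (hr : 0 ≤ r) (hr1 : r < 1) :
    ∑' m : ℕ, ENNReal.ofReal (Real.Gamma (β + m) * (r ^ m / m.factorial)) =
      ENNReal.ofReal ((1 - r) ^ (-β) * Real.Gamma β) := by
  rw [← lintegral_rpow_mul_exp_neg_mul hβ (by linarith : 0 < 1 - r)]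
  have hG : ∀ m : ℕ, 0 ≤ Real.Gamma (β + m) := fun m => (Real.Gamma_pos_of_pos (by positivity)).le
  simp_rw [ENNReal.ofReal_mul (hG _), ofReal_Gamma_add_natCast hβ]
  simp_rw [← lintegral_mul_const' _ _ ENNReal.ofReal_ne_top]
  rw [← lintegral_tsum (by intro; fun_prop)]
  refine setLIntegral_congr_fun measurableSet_Ioi fun t ht => ?_
  have ht : (0 : ℝ) < t := ht
  simp only [mul_assoc]
  rw [ENNReal.tsum_mul_left]
  have : ∀ m : ℕ, ENNReal.ofReal (t ^ m) * ENNReal.ofReal (r ^ m / m.factorial) =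
      ENNReal.ofReal ((t * r) ^ m / m.factorial) := fun m => by
    rw [← ENNReal.ofReal_mul (by positivity), mul_pow, mul_div_assoc]
  simp_rw [this]
  rw [ENNReal.tsum_ofReal_pow_div_factorial (by positivity), ← ENNReal.ofReal_mul (by positivity),
    mul_assoc, ← Real.exp_add]
  ring_nf

/-- Product of two multivariate negative binomial series, one for each block of coordinates. -/
lemma tsum_Gamma_mul_Gamma_mul_prod {n : ℕ} (c : Fin n → Prop) [DecidablePred c] {β : ℝ}
    (hβ : 0 < β) (r : Fin n → ℝ) (hr : ∀ i, 0 ≤ r i)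
    (h₁ : ∑ i with c i, r i < 1) (h₂ : ∑ i with ¬ c i, r i < 1) :
    ∑' N : Fin n → ℕ, ENNReal.ofReal (Real.Gamma (β + (∑ i with c i, N i : ℕ)) *
        Real.Gamma (β + (∑ i with ¬ c i, N i : ℕ)) * ∏ i, (r i ^ N i / (N i).factorial)) =
      ENNReal.ofReal (((1 - ∑ i with c i, r i) ^ (-β) * Real.Gamma β) *
        ((1 - ∑ i with ¬ c i, r i) ^ (-β) * Real.Gamma β)) := by
  have hG : ∀ m : ℕ, 0 ≤ Real.Gamma (β + m) := fun m => (Real.Gamma_pos_of_pos (by positivity)).le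
  have hG0 : 0 < Real.Gamma β := Real.Gamma_pos_of_pos hβ
  set g : ℝ → ℝ≥0∞ := fun t => ENNReal.ofReal (t ^ (β - 1) * Real.exp (-t)) with hg
  -- With both `Γ` factors written as integrals over `t` and `s`, the sum over `N` factorizes into
  -- exponential series.
  have step : ∀ N : Fin n → ℕ, ENNReal.ofReal (Real.Gamma (β + (∑ i with c i, N i : ℕ)) *
        Real.Gamma (β + (∑ i with ¬ c i, N i : ℕ)) * ∏ i, (r i ^ N i / (N i).factorial)) =
      ∫⁻ t in Set.Ioi (0 : ℝ), ∫⁻ s in Set.Ioi (0 : ℝ), g t * (g s *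
        ∏ i, ENNReal.ofReal (((if c i then t else s) * r i) ^ N i / (N i).factorial)) := by
    intro N
    rw [ENNReal.ofReal_mul (mul_nonneg (hG _) (hG _)), ENNReal.ofReal_mul (hG _),
      ofReal_Gamma_add_natCast hβ, ofReal_Gamma_add_natCast hβ,
      ← lintegral_mul_const' _ _ (by rw [← ofReal_Gamma_add_natCast hβ]; exact ENNReal.ofReal_ne_top),
      ← lintegral_mul_const' _ _ ENNReal.ofReal_ne_top]
    refine setLIntegral_congr_fun measurableSet_Ioi fun t ht => ?_
    have ht : (0 : ℝ) < t := ht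
    rw [← lintegral_const_mul' _ _ (by finiteness), ← lintegral_mul_const' _ _ ENNReal.ofReal_ne_top]
    refine setLIntegral_congr_fun measurableSet_Ioi fun s hs => ?_
    have hs : (0 : ℝ) < s := hs
    have key : t ^ (∑ i with c i, N i) * s ^ (∑ i with ¬ c i, N i) *
        ∏ i, (r i ^ N i / (N i).factorial) =
        ∏ i, (((if c i then t else s) * r i) ^ N i / (N i).factorial) := by
      simp only [mul_pow, mul_div_assoc, Finset.prod_mul_distrib, ← Finset.prod_pow_eq_pow_sum]
      congr 1
      rw [← Finset.prod_filter_mul_prod_filter_not Finset.univ c]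
      congr 1 <;>
      · refine Finset.prod_congr rfl fun i hi => ?_
        simp only [Finset.mem_filter] at hi
        simp [hi.2]
    rw [← ENNReal.ofReal_prod_of_nonneg (fun i _ => by
      have := hr i
      split_ifs <;> positivity), ← key]
    change g t * _ * (g s * _) * _ = _
    rw [ENNReal.ofReal_mul (by positivity), ENNReal.ofReal_mul (by positivity)]
    ring
  simp_rw [step]
  rw [← lintegral_tsum fun N => (Measurable.lintegral_prod_right (by
    refine Measurable.mul (by fun_prop) (Measurable.mul (by fun_prop) ?_)
    refine Finset.measurable_prod _ fun i _ => ?_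
    split_ifs <;> fun_prop)).aemeasurable]
  rw [ENNReal.ofReal_mul (by
      have : 0 < 1 - ∑ i with c i, r i := by linarith
      positivity), ← lintegral_rpow_mul_exp_neg_mul hβ (by linarith),
      ← lintegral_rpow_mul_exp_neg_mul hβ (by linarith), ← lintegral_mul_const _ (by fun_prop)]
  refine setLIntegral_congr_fun measurableSet_Ioi fun t ht => ?_
  have ht : (0 : ℝ) < t := ht
  rw [← lintegral_tsum fun N => by
    refine Measurable.aemeasurable ?_
    refine Measurable.mul (by fun_prop) (Measurable.mul (by fun_prop) ?_)
    refine Finset.measurable_prod _ fun i _ => ?_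
    split_ifs <;> fun_prop]
  rw [← lintegral_const_mul' _ _ ENNReal.ofReal_ne_top]
  refine setLIntegral_congr_fun measurableSet_Ioi fun s hs => ?_
  have hs : (0 : ℝ) < s := hs
  rw [ENNReal.tsum_mul_left, ENNReal.tsum_mul_left, ENNReal.tsum_pi_prod
    (fun i m => ENNReal.ofReal (((if c i then t else s) * r i) ^ m / m.factorial))]
  have : ∀ i, ∑' m : ℕ, ENNReal.ofReal (((if c i then t else s) * r i) ^ m / m.factorial) =
      ENNReal.ofReal (Real.exp ((if c i then t else s) * r i)) := fun i =>
    ENNReal.tsum_ofReal_pow_div_factorial (by have := hr i; split_ifs <;> positivity)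
  simp_rw [this]
  rw [← ENNReal.ofReal_prod_of_nonneg (fun i _ => (Real.exp_pos _).le), ← Real.exp_sum]
  have hsum : ∑ i, (if c i then t else s) * r i =
      t * ∑ i with c i, r i + s * ∑ i with ¬ c i, r i := by
    rw [← Finset.sum_filter_add_sum_filter_not Finset.univ c, Finset.mul_sum, Finset.mul_sum]
    congr 1 <;>
    · refine Finset.sum_congr rfl fun i hi => ?_
      simp only [Finset.mem_filter] at hi
      simp [hi.2]
  simp only [hg]
  rw [hsum, ← ENNReal.ofReal_mul (by positivity), ← ENNReal.ofReal_mul (by positivity),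
    ← ENNReal.ofReal_mul (by positivity), Real.exp_add]
  congr 1
  rw [show -((1 - ∑ i with c i, r i) * t) = -t + t * ∑ i with c i, r i by ring,
    show -((1 - ∑ i with ¬ c i, r i) * s) = -s + s * ∑ i with ¬ c i, r i by ring,
    Real.exp_add, Real.exp_add]
  ring

/-! ### Injectivity of the Laplace transform on the nonnegative orthant. -/

/-- The bounded continuous function `x ↦ exp (-∑ i, t i * x i)` on the nonnegative orthant. -/
def expNegBCF {ι : Type*} [Fintype ι] (t : ι → ℝ≥0) : (ι → ℝ≥0) →ᵇ ℝ :=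
  BoundedContinuousFunction.ofNormedAddCommGroup
    (fun x => Real.exp (-∑ i, (t i : ℝ) * (x i : ℝ))) (by fun_prop) 1 fun x => by
      rw [Real.norm_eq_abs, Real.abs_exp, Real.exp_le_one_iff, neg_nonpos]
      positivity

lemma expNegBCF_apply {ι : Type*} [Fintype ι] (t x : ι → ℝ≥0) :
    expNegBCF t x = Real.exp (-∑ i, (t i : ℝ) * (x i : ℝ)) := rfl

/-- The functions `expNegBCF t` form a submonoid. -/
def expNegSubmonoid (ι : Type*) [Fintype ι] : Submonoid ((ι → ℝ≥0) →ᵇ ℝ) where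
  carrier := Set.range expNegBCF
  one_mem' := ⟨0, by ext x; simp [expNegBCF_apply]⟩
  mul_mem' := by
    rintro _ _ ⟨s, rfl⟩ ⟨t, rfl⟩
    refine ⟨s + t, ?_⟩
    ext x
    simp only [expNegBCF_apply, BoundedContinuousFunction.coe_mul, Pi.mul_apply, ← Real.exp_add,
      Pi.add_apply, NNReal.coe_add, add_mul, Finset.sum_add_distrib]
    ring_nf

/-- The linear span of the functions `expNegBCF t`, as a star subalgebra. -/
def expNegSubalgebra (ι : Type*) [Fintype ι] :
    StarSubalgebra ℝ ((ι → ℝ≥0) →ᵇ ℝ) where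
  __ := Algebra.adjoin ℝ (expNegSubmonoid ι : Set ((ι → ℝ≥0) →ᵇ ℝ))
  star_mem' {f} hf := by
    have : star f = f := by ext x; simp
    rwa [this]

/-- The exponentials are closed under products, so the algebra they generate is only their linear
span, and equality of integrals extends to it by linearity. -/
lemma mem_expNegSubalgebra {ι : Type*} [Fintype ι] {f : (ι → ℝ≥0) →ᵇ ℝ} :
    f ∈ expNegSubalgebra ι ↔ f ∈ Submodule.span ℝ (Set.range (expNegBCF (ι := ι))) := by
  change f ∈ Subalgebra.toSubmodule (Algebra.adjoin ℝ (expNegSubmonoid ι : Set _)) ↔ _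
  rw [Algebra.adjoin_eq_span, Submonoid.closure_eq]
  rfl

lemma expNegSubalgebra_separatesPoints (ι : Type*) [Fintype ι] :
    ((expNegSubalgebra ι).map
      (BoundedContinuousFunction.toContinuousMapStarₐ ℝ)).SeparatesPoints := by
  classical
  intro x y hxy
  obtain ⟨i, hi⟩ := Function.ne_iff.1 hxy
  refine ⟨_, ⟨_, ⟨expNegBCF (Pi.single i 1), ?_, rfl⟩, rfl⟩, ?_⟩
  · exact mem_expNegSubalgebra.2 (Submodule.subset_span ⟨_, rfl⟩)
  · change expNegBCF _ x ≠ expNegBCF _ y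
    simp only [expNegBCF_apply, ne_eq, Real.exp_eq_exp, neg_inj]
    have : ∀ z : ι → ℝ≥0, ∑ j, ((Pi.single i 1 : ι → ℝ≥0) j : ℝ) * (z j : ℝ) = z i := fun z => by
      rw [Finset.sum_eq_single i] <;> simp +contextual
    rw [this, this]
    exact_mod_cast hi

/-- Two finite measures on `(ι → ℝ≥0)` with the same Laplace transform are equal. -/
lemma ext_of_integral_expNegBCF {ι : Type*} [Fintype ι] {μ ν : Measure (ι → ℝ≥0)}
    [IsFiniteMeasure μ] [IsFiniteMeasure ν]
    (h : ∀ t, ∫ x, expNegBCF t x ∂μ = ∫ x, expNegBCF t x ∂ν) : μ = ν := by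
  refine ext_of_forall_mem_subalgebra_integral_eq_of_polish
    (expNegSubalgebra_separatesPoints ι) fun g hg => ?_
  rw [mem_expNegSubalgebra] at hg
  induction hg using Submodule.span_induction with
  | mem f hf => obtain ⟨t, rfl⟩ := hf; exact h t
  | zero => simp
  | add f g _ _ hf hg =>
    simp only [BoundedContinuousFunction.coe_add, Pi.add_apply]
    rw [integral_add (f.integrable μ) (g.integrable μ),
      integral_add (f.integrable ν) (g.integrable ν), hf, hg]
  | smul c f _ hf =>
    simp only [BoundedContinuousFunction.coe_smul]
    rw [integral_smul, integral_smul, hf]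

/-- Two finite measures concentrated on the nonnegative orthant with the same Laplace transform
are equal. -/
lemma ext_of_laplace_of_ae_nonneg {ι : Type*} [Fintype ι] {μ ν : Measure (ι → ℝ)}
    [IsFiniteMeasure μ] [IsFiniteMeasure ν]
    (hμ : ∀ᵐ x ∂μ, ∀ i, 0 ≤ x i) (hν : ∀ᵐ x ∂ν, ∀ i, 0 ≤ x i)
    (h : ∀ t : ι → ℝ, (∀ i, 0 ≤ t i) →
      ∫ x, Real.exp (-∑ i, t i * x i) ∂μ = ∫ x, Real.exp (-∑ i, t i * x i) ∂ν) : μ = ν := by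
  -- The exponentials are bounded only on the orthant, so both measures are transported there;
  -- nothing is lost because they are concentrated on it.
  set e : (ι → ℝ) → (ι → ℝ≥0) := fun x i => (x i).toNNReal with he
  set j : (ι → ℝ≥0) → (ι → ℝ) := fun x i => x i with hj
  have hem : Measurable e := by fun_prop
  have hjm : Measurable j := by fun_prop
  have hback : ∀ κ : Measure (ι → ℝ), (∀ᵐ x ∂κ, ∀ i, 0 ≤ x i) → (κ.map e).map j = κ := by
    intro κ hκ
    rw [Measure.map_map hjm hem]
    conv_rhs => rw [← Measure.map_id (μ := κ)]
    refine Measure.map_congr ?_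
    filter_upwards [hκ] with x hx
    ext i
    simp [he, hj, hx i]
  have hint : ∀ κ : Measure (ι → ℝ), (∀ᵐ x ∂κ, ∀ i, 0 ≤ x i) → ∀ t : ι → ℝ≥0,
      ∫ x, expNegBCF t x ∂(κ.map e) = ∫ x, Real.exp (-∑ i, (t i : ℝ) * x i) ∂κ := by
    intro κ hκ t
    rw [integral_map hem.aemeasurable (expNegBCF t).continuous.aestronglyMeasurable]
    refine integral_congr_ae ?_
    filter_upwards [hκ] with x hx
    simp [expNegBCF_apply, he, hx]
  rw [← hback μ hμ, ← hback ν hν]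
  congr 1
  refine ext_of_integral_expNegBCF fun t => ?_
  rw [hint μ hμ, hint ν hν]
  exact h (fun i => t i) fun i => (t i).2

/-! ### The determinant. -/

/-- Once the diagonal factor is pulled out, what remains is a rank-two perturbation `1 + U * V` of
the identity, one column of `U` per block. Exchanging the factors leaves the 2 × 2 determinant of `1
+ V * U`. -/
lemma det_one_add_blockFactorCorr_mul_diagonal {n : ℕ} (n₁ : ℕ) (a : Fin n → ℝ) (ϑ : ℝ)
    (c : Fin n → Prop) [DecidablePred c] (hc : ∀ i, c i ↔ (i : ℕ) < n₁)
    (t : Fin n → ℝ) (h : ∀ i, 1 + (1 - a i ^ 2) * t i ≠ 0) (s : Fin n → ℝ)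
    (hs : ∀ i, s i = a i ^ 2 * t i / (1 + (1 - a i ^ 2) * t i)) :
    (1 + blockFactorCorr n₁ a ϑ * Matrix.diagonal t).det =
      (∏ i, (1 + (1 - a i ^ 2) * t i)) *
        ((1 + ∑ i with c i, s i) * (1 + ∑ i with ¬ c i, s i) -
          ϑ ^ 2 * (∑ i with c i, s i) * ∑ i with ¬ c i, s i) := by
  set e : Fin n → ℝ := fun i => 1 + (1 - a i ^ 2) * t i with he
  set U : Matrix (Fin n) (Fin 2) ℝ := Matrix.of fun i b =>
    (e i)⁻¹ * a i * (if (c i ↔ b = 0) then 1 else ϑ) with hU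
  set V : Matrix (Fin 2) (Fin n) ℝ := Matrix.of fun b j =>
    if (c j ↔ b = 0) then a j * t j else 0 with hV
  have hfac : 1 + blockFactorCorr n₁ a ϑ * Matrix.diagonal t =
      Matrix.diagonal e * (1 + U * V) := by
    ext i j
    have hi := h i
    rw [Matrix.mul_add, mul_one, Matrix.add_apply, Matrix.add_apply, Matrix.diagonal_mul,
      Matrix.mul_diagonal, Matrix.mul_apply, Fin.sum_univ_two, blockFactorCorr, Matrix.add_apply, Matrix.of_apply]
    rcases eq_or_ne i j with rfl | hij
    · by_cases hc' : c i <;>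
      · simp [hU, hV, hc', he]
        field_simp
        ring
    · by_cases hc' : c i <;> by_cases hd : c j <;>
      · simp [hU, hV, he, ← hc, hc', hd, hij]
        field_simp
  rw [hfac, Matrix.det_mul, Matrix.det_diagonal, Matrix.det_one_add_mul_comm, Matrix.det_fin_two]
  congr 1
  have hVU : ∀ b b' : Fin 2, (V * U) b b' =
      (if b = b' then 1 else ϑ) * ∑ j : Fin n, if (c j ↔ b = 0) then
        s j else 0 := by
    intro b b'
    rw [Finset.mul_sum, Matrix.mul_apply]
    refine Finset.sum_congr rfl fun j _ => ?_
    by_cases hc' : c j <;> fin_cases b <;> fin_cases b' <;> simp [hU, hV, hc', hs, he] <;> ring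
  simp only [Matrix.add_apply, hVU, Finset.sum_filter, Matrix.one_apply]
  simp
  ring

/-! ### Total positivity of gamma distributions. -/

/-- A measure of the form `f • volume` whose density is totally positive of order 2 against that of
`g • volume` has its distribution function totally positive of order 2 as well. -/
lemma withDensity_mul_withDensity_le {Ω : Type*} [MeasurableSpace Ω] [LE Ω] (ν : Measure Ω)
    {f g : Ω → ℝ≥0∞} (hf : Measurable f) (hg : Measurable g)
    (hfg : ∀ u v, u ≤ v → g u * f v ≤ f u * g v) {S T : Set Ω} (hS : MeasurableSet S)
    (hT : MeasurableSet T) (hST : S ⊆ T) (hlt : ∀ u ∈ S, ∀ v ∈ T \ S, u ≤ v) :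
    ν.withDensity g S * ν.withDensity f T ≤ ν.withDensity f S * ν.withDensity g T := by
  have hD : MeasurableSet (T \ S) := hT.diff hS
  have split : ∀ h : Ω → ℝ≥0∞,
      ν.withDensity h T = ν.withDensity h S + ν.withDensity h (T \ S) := fun h => by
    rw [← measure_union Set.disjoint_sdiff_right hD, Set.union_sdiff_cancel hST]
  have hdouble : ∀ h k : Ω → ℝ≥0∞, Measurable h → Measurable k →
      ν.withDensity h S * ν.withDensity k (T \ S) =
        ∫⁻ u in S, ∫⁻ v in T \ S, h u * k v ∂ν ∂ν := fun h k hh hk => by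
    rw [withDensity_apply _ hS, withDensity_apply _ hD, ← lintegral_mul_const _ hh]
    simp_rw [lintegral_const_mul _ hk]
  -- The contributions of `S × S` agree on both sides; only `S × (T \ S)` is left, where the
  -- densities compare pointwise.
  rw [split f, split g, mul_add, mul_add, mul_comm (ν.withDensity g S) (ν.withDensity f S)]
  gcongr 1
  rw [hdouble g f hg hf, hdouble f g hf hg]
  exact setLIntegral_mono' hS fun u hu => setLIntegral_mono' hD fun v hv => hfg u v (hlt u hu v hv)

/-- Monotone likelihood ratio: on the positive axis the quotient of the two densities is a constant
times `u ^ (m' - m)`. -/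
lemma gammaPDFReal_mul_gammaPDFReal_le {α r : ℝ} (hα : 0 < α) (hr : 0 < r) {m m' : ℕ}
    (hm : m ≤ m') {u v : ℝ} (huv : u ≤ v) :
    gammaPDFReal (α + m') r u * gammaPDFReal (α + m) r v ≤
      gammaPDFReal (α + m) r u * gammaPDFReal (α + m') r v := by
  rcases hm.eq_or_lt with rfl | hlt
  · rfl
  rcases lt_or_ge u 0 with hu | hu
  · simp [gammaPDFReal, hu.not_ge]
  have hv : 0 ≤ v := hu.trans huv
  have hG := Real.Gamma_pos_of_pos (show 0 < α + m by positivity)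
  have hG' := Real.Gamma_pos_of_pos (show 0 < α + m' by positivity)
  simp only [gammaPDFReal, if_pos hu, if_pos hv]
  have key : u ^ (α + m' - 1) * v ^ (α + m - 1) ≤ u ^ (α + m - 1) * v ^ (α + m' - 1) := by
    rcases hu.eq_or_lt with rfl | hu
    -- At the origin `m' ≥ 1` makes the exponent positive, which excludes `0 ^ 0 = 1`.
    · have h1 : (1 : ℝ) ≤ m' := by exact_mod_cast (by omega : 1 ≤ m')
      rw [Real.zero_rpow (by linarith), zero_mul]
      positivity
    · have hv : 0 < v := hu.trans_le huv
      obtain ⟨k, rfl⟩ := Nat.exists_eq_add_of_le hm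
      have : α + ((m + k : ℕ) : ℝ) - 1 = (α + m - 1) + k := by push_cast; ring
      rw [this, Real.rpow_add hu, Real.rpow_add hv, Real.rpow_natCast, Real.rpow_natCast]
      calc u ^ (α + m - 1) * u ^ k * v ^ (α + m - 1)
          = u ^ (α + m - 1) * v ^ (α + m - 1) * u ^ k := by ring
        _ ≤ u ^ (α + m - 1) * v ^ (α + m - 1) * v ^ k := by gcongr
        _ = _ := by ring
  calc _ = (r ^ (α + m') / Real.Gamma (α + m') * (r ^ (α + m) / Real.Gamma (α + m)) *
        Real.exp (-(r * u)) * Real.exp (-(r * v))) *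
          (u ^ (α + m' - 1) * v ^ (α + m - 1)) := by ring
    _ ≤ (r ^ (α + m') / Real.Gamma (α + m') * (r ^ (α + m) / Real.Gamma (α + m)) *
        Real.exp (-(r * u)) * Real.exp (-(r * v))) *
          (u ^ (α + m - 1) * v ^ (α + m' - 1)) := by gcongr
    _ = _ := by ring

/-- The lower set of reals bounded by an extended real. -/
def realIic (x : EReal) : Set ℝ := {u | (u : EReal) ≤ x}

lemma measurableSet_realIic (x : EReal) : MeasurableSet (realIic x) :=
  measurable_coe_real_ereal measurableSet_Iic

/-- The distribution function of a gamma distribution at an extended real. -/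
def gammaECDF (a r : ℝ) (x : EReal) : ℝ := (gammaMeasure a r).real (realIic x)

lemma gammaECDF_nonneg (a r : ℝ) (x : EReal) : 0 ≤ gammaECDF a r x := measureReal_nonneg

lemma gammaECDF_pos {a r : ℝ} (ha : 0 < a) (hr : 0 < r) {x : EReal} (hx : 0 < x) :
    0 < gammaECDF a r x := by
  have := isProbabilityMeasure_gammaMeasure ha hr
  obtain ⟨y, hy0, hyx⟩ := EReal.exists_between_coe_real hx
  have hy : 0 < y := by exact_mod_cast hy0
  refine ENNReal.toReal_pos ?_ (measure_ne_top _ _)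
  have hsub : Set.Ioo 0 y ⊆ realIic x := fun u hu =>
    (EReal.coe_le_coe_iff.2 hu.2.le).trans hyx.le
  refine ((measure_mono hsub).trans_lt' ?_).ne'
  rw [gammaMeasure, withDensity_apply _ measurableSet_Ioo, setLIntegral_pos_iff
    (show Measurable (gammaPDF a r) from (measurable_gammaPDFReal a r).ennreal_ofReal)]
  have : Function.support (gammaPDF a r) ∩ Set.Ioo 0 y = Set.Ioo 0 y :=
    Set.inter_eq_right.2 fun u hu =>
      (ENNReal.ofReal_pos.2 (gammaPDFReal_pos ha hr hu.1)).ne'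
  rw [this]
  simpa using hy

lemma gammaECDF_mul_le {α r : ℝ} (hα : 0 < α) (hr : 0 < r) {m m' : ℕ} (hm : m ≤ m')
    {x y : EReal} (hxy : x ≤ y) :
    gammaECDF (α + m') r x * gammaECDF (α + m) r y ≤
      gammaECDF (α + m) r x * gammaECDF (α + m') r y := by
  have h1 := isProbabilityMeasure_gammaMeasure (show 0 < α + m by positivity) hr
  have h2 := isProbabilityMeasure_gammaMeasure (show 0 < α + m' by positivity) hr
  simp only [gammaECDF, measureReal_def, ← ENNReal.toReal_mul]
  refine ENNReal.toReal_mono (by finiteness) ?_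
  refine withDensity_mul_withDensity_le volume (measurable_gammaPDFReal _ _).ennreal_ofReal
    (measurable_gammaPDFReal _ _).ennreal_ofReal (fun u v huv => ?_) (measurableSet_realIic x)
    (measurableSet_realIic y) (fun u hu => le_trans hu hxy) fun u hu v hv => ?_
  · rw [← ENNReal.ofReal_mul (gammaPDFReal_nonneg (by positivity) hr _),
      ← ENNReal.ofReal_mul (gammaPDFReal_nonneg (by positivity) hr _)]
    exact ENNReal.ofReal_le_ofReal (gammaPDFReal_mul_gammaPDFReal_le hα hr hm huv)
  · exact EReal.coe_le_coe_iff.1 (hu.trans (not_le.1 hv.2).le)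

/-- Total positivity of order 2 in lattice form. -/
lemma gammaECDF_mul_le_inf_sup {α r : ℝ} (hα : 0 < α) (hr : 0 < r) (m m' : ℕ) (x y : EReal) :
    gammaECDF (α + m) r x * gammaECDF (α + m') r y ≤
      gammaECDF (α + (m ⊓ m' : ℕ)) r (x ⊓ y) * gammaECDF (α + (m ⊔ m' : ℕ)) r (x ⊔ y) := by
  rcases le_total m m' with hm | hm <;> rcases le_total x y with hxy | hxy
  · simp [hm, hxy]
  · simp only [hm, hxy, inf_of_le_left, inf_of_le_right, sup_of_le_left, sup_of_le_right]
    rw [mul_comm]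
    exact gammaECDF_mul_le hα hr hm hxy
  · simp only [hm, hxy, inf_of_le_left, inf_of_le_right, sup_of_le_left, sup_of_le_right]
    exact gammaECDF_mul_le hα hr hm hxy
  · simp only [hm, hxy, inf_of_le_right, sup_of_le_left]
    rw [mul_comm]

/-! ### Log-supermodularity and the four functions theorem. -/

/-- `Γ(α + m + j) / Γ(α + m)` is a product of `j` factors `α + m + i`, each increasing in `m`. -/
lemma Gamma_add_natCast_mul_le {α : ℝ} (hα : 0 < α) {b c j : ℕ} (hcb : c ≤ b) :
    Real.Gamma (α + (c + j : ℕ)) * Real.Gamma (α + b) ≤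
      Real.Gamma (α + c) * Real.Gamma (α + (b + j : ℕ)) := by
  have hG : ∀ m : ℕ, 0 < Real.Gamma (α + m) := fun m => Real.Gamma_pos_of_pos (by positivity)
  have hstep : ∀ m : ℕ, Real.Gamma (α + (m + 1 : ℕ)) = (α + m) * Real.Gamma (α + m) := fun m => by
    rw [← Real.Gamma_add_one (by positivity)]
    push_cast
    ring_nf
  induction j with
  | zero => simp
  | succ j ih =>
    rw [← add_assoc, ← add_assoc, hstep, hstep]
    calc (α + (c + j : ℕ)) * Real.Gamma (α + (c + j : ℕ)) * Real.Gamma (α + b)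
        = (α + (c + j : ℕ)) * (Real.Gamma (α + (c + j : ℕ)) * Real.Gamma (α + b)) := by ring
      _ ≤ (α + (b + j : ℕ)) * (Real.Gamma (α + c) * Real.Gamma (α + (b + j : ℕ))) := by
        have := hG (c + j)
        have := hG b
        gcongr
      _ = _ := by ring

/-- Log-convexity of `m ↦ Γ(α + m)` gives log-supermodularity along an additive modular function. -/
lemma Gamma_mul_Gamma_le_of_modular {L : Type*} [Lattice L] {α : ℝ} (hα : 0 < α) {φ : L → ℕ}
    (hmono : Monotone φ) (hmod : ∀ u v, φ u + φ v = φ (u ⊓ v) + φ (u ⊔ v)) (u v : L) :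
    Real.Gamma (α + φ u) * Real.Gamma (α + φ v) ≤
      Real.Gamma (α + φ (u ⊓ v)) * Real.Gamma (α + φ (u ⊔ v)) := by
  obtain ⟨j, hj⟩ := Nat.exists_eq_add_of_le (hmono (inf_le_left : u ⊓ v ≤ u))
  have hs : φ (u ⊔ v) = φ v + j := by have := hmod u v; omega
  rw [hs, hj]
  exact Gamma_add_natCast_mul_le hα (hmono inf_le_right)

/-- On a chain the pair `u, v` is the pair `u ⊓ v, u ⊔ v` up to order, so factors depending on a
single coordinate give equality. -/
lemma mul_eq_inf_mul_sup {L R : Type*} [LinearOrder L] [CommSemigroup R] (f : L → R) (u v : L) :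
    f u * f v = f (u ⊓ v) * f (u ⊔ v) := by
  rcases le_total u v with h | h
  · simp [h]
  · simp [h, mul_comm]

/-- The four functions theorem for summable functions on a distributive lattice. -/
lemma tsum_mul_tsum_le_of_four_functions {L : Type*} [DistribLattice L] {f₁ f₂ f₃ f₄ : L → ℝ}
    (h₁ : 0 ≤ f₁) (h₂ : 0 ≤ f₂) (h₃ : 0 ≤ f₃) (h₄ : 0 ≤ f₄)
    (s₁ : Summable f₁) (s₂ : Summable f₂) (s₃ : Summable f₃) (s₄ : Summable f₄)
    (h : ∀ a b, f₁ a * f₂ b ≤ f₃ (a ⊓ b) * f₄ (a ⊔ b)) :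
    (∑' a, f₁ a) * ∑' a, f₂ a ≤ (∑' a, f₃ a) * ∑' a, f₄ a := by
  classical
  refine le_of_tendsto_of_tendsto' (s₁.hasSum.mul_const _) tendsto_const_nhds fun s => ?_
  refine le_of_tendsto_of_tendsto' (s₂.hasSum.const_mul _) tendsto_const_nhds fun t => ?_
  -- The finite theorem bounds by sums over the sets of meets and joins of `s` and `t`, which are at
  -- most the full series.
  exact (four_functions_theorem f₁ f₂ f₃ f₄ h₁ h₂ h₃ h₄ h s t).trans
    (mul_le_mul (s₃.sum_le_tsum _ fun _ _ => h₃ _) (s₄.sum_le_tsum _ fun _ _ => h₄ _)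
      (Finset.sum_nonneg fun _ _ => h₄ _) (tsum_nonneg h₃))

/-! ### Laplace transforms of gamma distributions and their products. -/

lemma lintegral_exp_neg_mul_gammaMeasure {a r t : ℝ} (ha : 0 < a) (hr : 0 < r) (ht : 0 ≤ t) :
    ∫⁻ x, ENNReal.ofReal (Real.exp (-(t * x))) ∂(gammaMeasure a r) =
      ENNReal.ofReal ((r / (r + t)) ^ a) := by
  have hG := Real.Gamma_pos_of_pos ha
  have hm : Measurable (gammaPDF a r) := (measurable_gammaPDFReal a r).ennreal_ofReal
  rw [gammaMeasure, lintegral_withDensity_eq_lintegral_mul _ hm (by fun_prop),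
    ← lintegral_add_compl _ (measurableSet_Ici (a := (0 : ℝ))), Set.compl_Ici,
    setLIntegral_congr_fun (g := fun _ => 0) measurableSet_Iio (fun x (hx : x < 0) => by
      simp [gammaPDF_of_neg hx]), lintegral_zero, add_zero, setLIntegral_congr Ioi_ae_eq_Ici.symm]
  have hfun : ∀ x ∈ Set.Ioi (0 : ℝ),
      (gammaPDF a r * fun x => ENNReal.ofReal (Real.exp (-(t * x)))) x =
        ENNReal.ofReal (r ^ a / Real.Gamma a) *
          ENNReal.ofReal (x ^ (a - 1) * Real.exp (-((r + t) * x))) := by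
    intro x hx
    have hx : 0 < x := hx
    rw [Pi.mul_apply, gammaPDF_of_nonneg hx.le, ← ENNReal.ofReal_mul (by positivity),
      ← ENNReal.ofReal_mul (by positivity), mul_assoc, mul_assoc, ← Real.exp_add]
    ring_nf
  rw [setLIntegral_congr_fun measurableSet_Ioi hfun, lintegral_const_mul _ (by fun_prop),
    lintegral_rpow_mul_exp_neg_mul ha (by positivity), ← ENNReal.ofReal_mul (by positivity),
    Real.rpow_neg (by positivity), Real.div_rpow hr.le (by positivity)]
  congr 1
  field_simp

lemma lintegral_exp_neg_sum_pi_gammaMeasure {ι : Type*} [Fintype ι] {a r t : ι → ℝ}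
    (ha : ∀ i, 0 < a i) (hr : ∀ i, 0 < r i) (ht : ∀ i, 0 ≤ t i) :
    ∫⁻ x, ENNReal.ofReal (Real.exp (-∑ i, t i * x i))
        ∂(Measure.pi fun i => gammaMeasure (a i) (r i)) =
      ENNReal.ofReal (∏ i, (r i / (r i + t i)) ^ a i) := by
  have := fun i => isProbabilityMeasure_gammaMeasure (ha i) (hr i)
  have hind : iIndepFun (fun i (x : ι → ℝ) => ENNReal.ofReal (Real.exp (-(t i * x i))))
      (Measure.pi fun i => gammaMeasure (a i) (r i)) :=
    iIndepFun_pi (X := fun i x => ENNReal.ofReal (Real.exp (-(t i * x)))) fun i => by fun_prop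
  have hexp : ∀ x : ι → ℝ, ENNReal.ofReal (Real.exp (-∑ i, t i * x i)) =
      ∏ i, ENNReal.ofReal (Real.exp (-(t i * x i))) := fun x => by
    rw [← ENNReal.ofReal_prod_of_nonneg fun _ _ => (Real.exp_pos _).le, ← Real.exp_sum,
      Finset.sum_neg_distrib]
  simp_rw [hexp]
  rw [lintegral_prod_eq_prod_lintegral_of_indepFun _ _ hind (fun i => by fun_prop),
    ENNReal.ofReal_prod_of_nonneg fun i _ => by have := hr i; have := ht i; positivity]
  refine Finset.prod_congr rfl fun i _ => ?_
  rw [← lintegral_exp_neg_mul_gammaMeasure (ha i) (hr i) (ht i)]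
  exact (measurePreserving_eval (fun i => gammaMeasure (a i) (r i)) i).lintegral_comp
    (f := fun x => ENNReal.ofReal (Real.exp (-(t i * x)))) (by fun_prop)

/-! ### Gamma mixtures and their distribution functions. -/

section Mixture

variable {n : ℕ} (c : Fin n → Prop) [DecidablePred c]

/-- Weights of a mixture of products of gamma distributions, with two blocks of coordinates. -/
def mixWeight (C α θ : ℝ) (p : Fin n → ℝ) (u : ℕ × (Fin n → ℕ)) : ℝ :=
  C * (θ ^ u.1 / (u.1.factorial * Real.Gamma (α + u.1))) *
    (Real.Gamma (α + (u.1 + ∑ i with c i, u.2 i : ℕ)) *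
      Real.Gamma (α + (u.1 + ∑ i with ¬ c i, u.2 i : ℕ)) *
        ∏ i, (p i ^ u.2 i / (u.2 i).factorial))

/-- The mixture, with weights `mixWeight`, of the products of the gamma distributions with shapes
`α + Nᵢ` and rates `rᵢ`. -/
def gammaMixture (C α θ : ℝ) (p r : Fin n → ℝ) : Measure (Fin n → ℝ) :=
  Measure.sum fun u : ℕ × (Fin n → ℕ) => ENNReal.ofReal (mixWeight c C α θ p u) •
    Measure.pi fun i => gammaMeasure (α + u.2 i) (r i)

variable {C α θ : ℝ} {p r : Fin n → ℝ}

lemma mixWeight_nonneg (hC : 0 ≤ C) (hα : 0 < α) (hθ : 0 ≤ θ) (hp : ∀ i, 0 ≤ p i)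
    (u : ℕ × (Fin n → ℕ)) : 0 ≤ mixWeight c C α θ p u := by
  have hG : ∀ m : ℕ, 0 ≤ Real.Gamma (α + m) := fun m => (Real.Gamma_pos_of_pos (by positivity)).le
  have := Finset.prod_nonneg fun i (_ : i ∈ Finset.univ) =>
    div_nonneg (pow_nonneg (hp i) (u.2 i)) (Nat.cast_nonneg (α := ℝ) (u.2 i).factorial)
  have := hG u.1
  have := hG (u.1 + ∑ i with c i, u.2 i)
  have := hG (u.1 + ∑ i with ¬ c i, u.2 i)
  unfold mixWeight
  positivity

/-- All other weights may vanish (when `θ` and the `p i` are zero); this one never does, and it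
alone makes the cdf positive. -/
lemma mixWeight_zero_pos (hC : 0 < C) (hα : 0 < α) : 0 < mixWeight c C α θ p 0 := by
  have := Real.Gamma_pos_of_pos hα
  simp [mixWeight]
  positivity

/-- For fixed `k` the sum over `N` produces `Γ(α + k) ^ 2 * (A * B) ^ (-(α + k))`. The `Γ(α + k)` in
the denominator of the weight cancels one factor, leaving a negative binomial series in `θ / (A *
B)`. -/
lemma tsum_mixWeight_mul_prod_pow (hC : 0 ≤ C) (hα : 0 < α) (hθ : 0 ≤ θ) (hp : ∀ i, 0 ≤ p i)
    {z : Fin n → ℝ} (hz : ∀ i, 0 ≤ z i) (h₁ : ∑ i with c i, p i * z i < 1)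
    (h₂ : ∑ i with ¬ c i, p i * z i < 1)
    (h : θ < (1 - ∑ i with c i, p i * z i) * (1 - ∑ i with ¬ c i, p i * z i)) :
    ∑' u, ENNReal.ofReal (mixWeight c C α θ p u * ∏ i, z i ^ u.2 i) =
      ENNReal.ofReal (C * Real.Gamma α *
        ((1 - ∑ i with c i, p i * z i) * (1 - ∑ i with ¬ c i, p i * z i) - θ) ^ (-α)) := by
  have hG : ∀ m : ℕ, 0 < Real.Gamma (α + m) := fun m => Real.Gamma_pos_of_pos (by positivity)
  have hG0 := Real.Gamma_pos_of_pos hα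
  set A := 1 - ∑ i with c i, p i * z i with hA
  set B := 1 - ∑ i with ¬ c i, p i * z i with hB
  have hA0 : 0 < A := by linarith
  have hB0 : 0 < B := by linarith
  have inner : ∀ k : ℕ, ∑' N : Fin n → ℕ,
      ENNReal.ofReal (mixWeight c C α θ p (k, N) * ∏ i, z i ^ N i) =
        ENNReal.ofReal (C * (A * B) ^ (-α)) *
          ENNReal.ofReal (Real.Gamma (α + k) * ((θ / (A * B)) ^ k / k.factorial)) := by
    intro k
    have hterm : ∀ N : Fin n → ℕ, mixWeight c C α θ p (k, N) * ∏ i, z i ^ N i =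
        C * (θ ^ k / (k.factorial * Real.Gamma (α + k))) *
          (Real.Gamma (α + k + (∑ i with c i, N i : ℕ)) *
            Real.Gamma (α + k + (∑ i with ¬ c i, N i : ℕ)) *
              ∏ i, ((p i * z i) ^ N i / (N i).factorial)) := by
      intro N
      have hprod : ∏ i, ((p i * z i) ^ N i / ((N i).factorial : ℝ)) =
          (∏ i, (p i ^ N i / ((N i).factorial : ℝ))) * ∏ i, z i ^ N i := by
        rw [← Finset.prod_mul_distrib]
        refine Finset.prod_congr rfl fun i _ => ?_
        rw [mul_pow]
        ring
      rw [hprod]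
      simp only [mixWeight, Nat.cast_add, ← add_assoc]
      ring
    have hc0 : 0 ≤ C * (θ ^ k / (k.factorial * Real.Gamma (α + k))) := by
      have := hG k
      positivity
    simp_rw [hterm, ENNReal.ofReal_mul hc0]
    rw [ENNReal.tsum_mul_left, tsum_Gamma_mul_Gamma_mul_prod c (by positivity) _
      (fun i => mul_nonneg (hp i) (hz i)) h₁ h₂, ← ENNReal.ofReal_mul hc0,
      ← ENNReal.ofReal_mul (by positivity), ← hA, ← hB]
    congr 1
    rw [div_pow, mul_pow, Real.mul_rpow hA0.le hB0.le, neg_add, Real.rpow_add hA0,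
      Real.rpow_add hB0, Real.rpow_neg hA0.le k, Real.rpow_neg hB0.le k, Real.rpow_natCast,
      Real.rpow_natCast]
    have := hG k
    field_simp
  have hθ1 : θ / (A * B) < 1 := by rwa [div_lt_one (by positivity)]
  rw [ENNReal.tsum_prod']
  simp_rw [inner]
  rw [ENNReal.tsum_mul_left, tsum_Gamma_mul_pow_div_factorial hα (by positivity) hθ1,
    ← ENNReal.ofReal_mul (by positivity)]
  congr 1
  rw [show A * B - θ = (A * B) * (1 - θ / (A * B)) by field_simp,
    Real.mul_rpow (y := 1 - θ / (A * B)) (by positivity) (by linarith)]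
  ring

/-- Component `N` has transform `∏ z i ^ (α + N i)`, so the mixture has `(∏ z i) ^ α` times the
generating function of the weights at `z`. -/
lemma lintegral_exp_neg_sum_gammaMixture (hC : 0 ≤ C) (hα : 0 < α) (hθ : 0 ≤ θ)
    (hp : ∀ i, 0 ≤ p i) (hr : ∀ i, 0 < r i) {t z : Fin n → ℝ} (ht : ∀ i, 0 ≤ t i)
    (hz : ∀ i, z i = r i / (r i + t i)) (h₁ : ∑ i with c i, p i * z i < 1)
    (h₂ : ∑ i with ¬ c i, p i * z i < 1)
    (h : θ < (1 - ∑ i with c i, p i * z i) * (1 - ∑ i with ¬ c i, p i * z i)) :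
    ∫⁻ x, ENNReal.ofReal (Real.exp (-∑ i, t i * x i)) ∂(gammaMixture c C α θ p r) =
      ENNReal.ofReal (C * Real.Gamma α * (∏ i, z i) ^ α *
        ((1 - ∑ i with c i, p i * z i) * (1 - ∑ i with ¬ c i, p i * z i) - θ) ^ (-α)) := by
  have hz0 : ∀ i, 0 < z i := fun i => by
    have := hr i; have := ht i; rw [hz]; positivity
  have hP0 : 0 ≤ (∏ i, z i) ^ α := Real.rpow_nonneg (Finset.prod_nonneg fun i _ => (hz0 i).le) _
  rw [gammaMixture, lintegral_sum_measure, mul_right_comm, mul_comm _ ((∏ i, z i) ^ α),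
    ENNReal.ofReal_mul hP0, ← tsum_mixWeight_mul_prod_pow c hC hα hθ hp (fun i => (hz0 i).le) h₁ h₂ h,
    ← ENNReal.tsum_mul_left]
  refine tsum_congr fun u => ?_
  rw [lintegral_smul_measure, lintegral_exp_neg_sum_pi_gammaMeasure (fun i => by positivity) hr ht,
    smul_eq_mul, ← ENNReal.ofReal_mul (mixWeight_nonneg c hC hα hθ hp u), ← ENNReal.ofReal_mul hP0,
    ← Real.finsetProd_rpow _ _ fun i _ => (hz0 i).le, mul_left_comm, ← Finset.prod_mul_distrib]
  congr 3 with i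
  rw [← hz, Real.rpow_add (hz0 i), Real.rpow_natCast]

lemma ae_nonneg_gammaMixture (hα : 0 < α) (hr : ∀ i, 0 < r i) :
    ∀ᵐ x ∂(gammaMixture c C α θ p r), ∀ i, 0 ≤ x i := by
  rw [gammaMixture, Measure.ae_sum_iff]
  intro u
  refine Measure.ae_smul_measure ?_ _
  have := fun i => isProbabilityMeasure_gammaMeasure (show 0 < α + u.2 i by positivity) (hr i)
  rw [ae_all_iff]
  intro i
  refine (Measure.quasiMeasurePreserving_eval
    (fun i => gammaMeasure (α + u.2 i) (r i)) i).ae (p := fun y => 0 ≤ y) ?_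
  rw [gammaMeasure, ae_withDensity_iff
    (show Measurable (gammaPDF (α + u.2 i) (r i)) from
      (measurable_gammaPDFReal _ _).ennreal_ofReal)]
  refine ae_of_all _ fun y hy => ?_
  by_contra hneg
  exact hy (gammaPDF_of_neg (not_le.1 hneg))

/-- The joint distribution function at extended reals. -/
def jointECDF (μ : Measure (Fin n → ℝ)) (e : Fin n → EReal) : ℝ :=
  μ.real {ω | ∀ i, (ω i : EReal) ≤ e i}

lemma hasSum_jointECDF_gammaMixture [IsFiniteMeasure (gammaMixture c C α θ p r)] (hC : 0 ≤ C) (hα : 0 < α)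
    (hθ : 0 ≤ θ) (hp : ∀ i, 0 ≤ p i) (hr : ∀ i, 0 < r i) (e : Fin n → EReal) :
    HasSum (fun u : ℕ × (Fin n → ℕ) => mixWeight c C α θ p u *
        ∏ i, gammaECDF (α + u.2 i) (r i) (e i))
      (jointECDF (gammaMixture c C α θ p r) e) := by
  have hset : {ω : Fin n → ℝ | ∀ i, (ω i : EReal) ≤ e i} =
      Set.univ.pi fun i => realIic (e i) := by
    ext ω; simp [realIic]
  have hmeas : MeasurableSet (Set.univ.pi fun i => realIic (e i)) :=
    .univ_pi fun i => measurableSet_realIic _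
  have hterm : ∀ u : ℕ × (Fin n → ℕ), mixWeight c C α θ p u *
      ∏ i, gammaECDF (α + u.2 i) (r i) (e i) = ((ENNReal.ofReal (mixWeight c C α θ p u) •
        Measure.pi fun i => gammaMeasure (α + u.2 i) (r i))
          (Set.univ.pi fun i => realIic (e i))).toReal := by
    intro u
    have := fun i => isProbabilityMeasure_gammaMeasure (show 0 < α + u.2 i by positivity) (hr i)
    rw [Measure.smul_apply, Measure.pi_pi, smul_eq_mul, ENNReal.toReal_mul,
      ENNReal.toReal_ofReal (mixWeight_nonneg c hC hα hθ hp u), ENNReal.toReal_prod]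
    rfl
  have htop : ∑' u : ℕ × (Fin n → ℕ), (ENNReal.ofReal (mixWeight c C α θ p u) •
        Measure.pi fun i => gammaMeasure (α + u.2 i) (r i))
          (Set.univ.pi fun i => realIic (e i)) =
      gammaMixture c C α θ p r (Set.univ.pi fun i => realIic (e i)) :=
    (Measure.sum_apply _ hmeas).symm
  have hne := measure_ne_top (gammaMixture c C α θ p r) (Set.univ.pi fun i => realIic (e i))
  rw [← htop] at hne
  simp_rw [hterm]
  rw [jointECDF, hset, measureReal_def, ← htop, ENNReal.tsum_toReal_eq
    (ENNReal.ne_top_of_tsum_ne_top hne)]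
  exact (ENNReal.summable_toReal hne).hasSum

/-- Only the two `Γ` factors in the numerator couple coordinates, each through the modular function
`k + ∑ N i` over a block. The factor `1 / Γ(α + k)`, log-concave in `k`, does no harm since it
depends on `k` alone. -/
lemma mixWeight_mul_le (hC : 0 ≤ C) (hα : 0 < α) (hθ : 0 ≤ θ) (hp : ∀ i, 0 ≤ p i)
    (u v : ℕ × (Fin n → ℕ)) :
    mixWeight c C α θ p u * mixWeight c C α θ p v ≤
      mixWeight c C α θ p (u ⊓ v) * mixWeight c C α θ p (u ⊔ v) := by
  have hG : ∀ m : ℕ, 0 ≤ Real.Gamma (α + m) := fun m => (Real.Gamma_pos_of_pos (by positivity)).le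
  have hmono : ∀ s : Finset (Fin n), Monotone fun w : ℕ × (Fin n → ℕ) => w.1 + ∑ i ∈ s, w.2 i :=
    fun s w w' h => add_le_add h.1 (Finset.sum_le_sum fun i _ => h.2 i)
  have hmod : ∀ (s : Finset (Fin n)) (w w' : ℕ × (Fin n → ℕ)),
      (w.1 + ∑ i ∈ s, w.2 i) + (w'.1 + ∑ i ∈ s, w'.2 i) =
        ((w ⊓ w').1 + ∑ i ∈ s, (w ⊓ w').2 i) + ((w ⊔ w').1 + ∑ i ∈ s, (w ⊔ w').2 i) := by
    intro s w w'
    have hk : w.1 + w'.1 = (w ⊓ w').1 + (w ⊔ w').1 := (min_add_max _ _).symm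
    have hN : ∑ i ∈ s, w.2 i + ∑ i ∈ s, w'.2 i =
        ∑ i ∈ s, (w ⊓ w').2 i + ∑ i ∈ s, (w ⊔ w').2 i := by
      rw [← Finset.sum_add_distrib, ← Finset.sum_add_distrib]
      exact Finset.sum_congr rfl fun i _ => (min_add_max _ _).symm
    omega
  have g₁ := Gamma_mul_Gamma_le_of_modular hα (hmono {i | c i}) (hmod _) u v
  have g₂ := Gamma_mul_Gamma_le_of_modular hα (hmono {i | ¬ c i}) (hmod _) u v
  have hk := mul_eq_inf_mul_sup
    (fun k : ℕ => C * (θ ^ k / (k.factorial * Real.Gamma (α + k)))) u.1 v.1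
  have hN : (∏ i, (p i ^ u.2 i / (u.2 i).factorial)) * ∏ i, (p i ^ v.2 i / (v.2 i).factorial) =
      (∏ i, (p i ^ (u ⊓ v).2 i / ((u ⊓ v).2 i).factorial)) *
        ∏ i, (p i ^ (u ⊔ v).2 i / ((u ⊔ v).2 i).factorial) := by
    simp only [← Finset.prod_mul_distrib]
    exact Finset.prod_congr rfl fun i _ =>
      mul_eq_inf_mul_sup (fun m : ℕ => p i ^ m / (m.factorial : ℝ)) (u.2 i) (v.2 i)
  have hP : ∀ w : ℕ × (Fin n → ℕ), 0 ≤ ∏ i, (p i ^ w.2 i / ((w.2 i).factorial : ℝ)) :=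
    fun w => Finset.prod_nonneg fun i _ => div_nonneg (pow_nonneg (hp i) _) (Nat.cast_nonneg _)
  have hK : ∀ k : ℕ, 0 ≤ C * (θ ^ k / (k.factorial * Real.Gamma (α + k))) := fun k => by
    have := hG k
    positivity
  have hmul := mul_le_mul g₁ g₂ (mul_nonneg (hG _) (hG _)) (mul_nonneg (hG _) (hG _))
  have hmul' := mul_le_mul_of_nonneg_left hmul (mul_nonneg (mul_nonneg (hK u.1) (hK v.1))
    (mul_nonneg (hP u) (hP v)))
  unfold mixWeight
  calc _ = _ := by ring
    _ ≤ _ := hmul'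
    _ = _ := by
      rw [hN]
      erw [hk]
      change _ = C * (θ ^ (u.1 ⊓ v.1) / ((u.1 ⊓ v.1).factorial * Real.Gamma (α + (u.1 ⊓ v.1 : ℕ)))) *
        _ * (C * (θ ^ (u.1 ⊔ v.1) / ((u.1 ⊔ v.1).factorial * Real.Gamma (α + (u.1 ⊔ v.1 : ℕ)))) * _)
      ring

/-- The joint distribution function of a gamma mixture is MTP₂. -/
lemma jointECDF_gammaMixture_mul_le [IsFiniteMeasure (gammaMixture c C α θ p r)] (hC : 0 ≤ C)
    (hα : 0 < α) (hθ : 0 ≤ θ) (hp : ∀ i, 0 ≤ p i) (hr : ∀ i, 0 < r i) (x y : Fin n → EReal) :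
    jointECDF (gammaMixture c C α θ p r) x * jointECDF (gammaMixture c C α θ p r) y ≤
      jointECDF (gammaMixture c C α θ p r) (x ⊓ y) *
        jointECDF (gammaMixture c C α θ p r) (x ⊔ y) := by
  have hs := hasSum_jointECDF_gammaMixture c hC hα hθ hp hr
  have hw := mixWeight_nonneg c hC hα hθ hp
  have hF : ∀ (N : Fin n → ℕ) (e : Fin n → EReal),
      0 ≤ ∏ i, gammaECDF (α + N i) (r i) (e i) :=
    fun N e => Finset.prod_nonneg fun i _ => gammaECDF_nonneg _ _ _
  have h0 : ∀ e : Fin n → EReal, 0 ≤ fun u : ℕ × (Fin n → ℕ) => mixWeight c C α θ p u *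
      ∏ i, gammaECDF (α + u.2 i) (r i) (e i) := fun e u => mul_nonneg (hw u) (hF _ _)
  have key := tsum_mul_tsum_le_of_four_functions (h0 x) (h0 y) (h0 (x ⊓ y)) (h0 (x ⊔ y))
    (hs x).summable (hs y).summable (hs (x ⊓ y)).summable (hs (x ⊔ y)).summable fun u v => by
      rw [mul_mul_mul_comm, mul_mul_mul_comm (mixWeight c C α θ p (u ⊓ v))]
      refine mul_le_mul (mixWeight_mul_le c hC hα hθ hp u v) ?_ (mul_nonneg (hF _ _) (hF _ _))
        (mul_nonneg (hw _) (hw _))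
      rw [← Finset.prod_mul_distrib, ← Finset.prod_mul_distrib]
      exact Finset.prod_le_prod
        (fun i _ => mul_nonneg (gammaECDF_nonneg _ _ _) (gammaECDF_nonneg _ _ _))
        fun i _ => gammaECDF_mul_le_inf_sup hα (hr i) (u.2 i) (v.2 i) (x i) (y i)
  rwa [(hs x).tsum_eq, (hs y).tsum_eq, (hs (x ⊓ y)).tsum_eq, (hs (x ⊔ y)).tsum_eq] at key

lemma jointECDF_gammaMixture_pos [IsFiniteMeasure (gammaMixture c C α θ p r)] (hC : 0 < C)
    (hα : 0 < α) (hθ : 0 ≤ θ) (hp : ∀ i, 0 ≤ p i) (hr : ∀ i, 0 < r i) {e : Fin n → EReal}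
    (he : ∀ i, 0 < e i) : 0 < jointECDF (gammaMixture c C α θ p r) e := by
  have hs := hasSum_jointECDF_gammaMixture c hC.le hα hθ hp hr e
  rw [← hs.tsum_eq]
  refine hs.summable.tsum_pos (fun u => mul_nonneg (mixWeight_nonneg c hC.le hα hθ hp u)
    (Finset.prod_nonneg fun i _ => gammaECDF_nonneg _ _ _)) 0
    (mul_pos (mixWeight_zero_pos c hC hα) (Finset.prod_pos fun i _ => ?_))
  exact gammaECDF_pos (by positivity) (hr i) (he i)

end Mixture

/-! ### Identification of the mixture parameters. -/

/-- The law `Γₙ(α, R_ϑ)` as a mixture of products of gamma distributions. -/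
lemma exists_gammaMixture_laplace {n : ℕ} (n₁ : ℕ) (a : Fin n → ℝ) (ha : ∀ i, |a i| < 1)
    (ϑ : ℝ) (hϑ : |ϑ| < 1) {α : ℝ} (hα : 0 < α)
    (c : Fin n → Prop) [DecidablePred c] (hc : ∀ i, c i ↔ (i : ℕ) < n₁) :
    ∃ (C θ : ℝ) (p r : Fin n → ℝ), 0 < C ∧ 0 ≤ θ ∧ (∀ i, 0 ≤ p i) ∧ (∀ i, 0 < r i) ∧
      ∀ t : Fin n → ℝ, (∀ i, 0 ≤ t i) →
        0 < (1 + blockFactorCorr n₁ a ϑ * Matrix.diagonal t).det ∧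
        ∫⁻ x, ENNReal.ofReal (Real.exp (-∑ i, t i * x i)) ∂(gammaMixture c C α θ p r) =
          ENNReal.ofReal ((1 + blockFactorCorr n₁ a ϑ * Matrix.diagonal t).det ^ (-α)) := by
  have hd : ∀ i, 0 < 1 - a i ^ 2 := fun i => sub_pos.2 ((sq_lt_one_iff_abs_lt_one _).2 (ha i))
  have hq : 0 < 1 - ϑ ^ 2 := sub_pos.2 ((sq_lt_one_iff_abs_lt_one _).2 hϑ)
  have hG := Real.Gamma_pos_of_pos hα
  set q := 1 - ϑ ^ 2 with hq_def
  -- Chosen so that `s i = l i - l i * z i` is affine in `z i`.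
  set l : Fin n → ℝ := fun i => a i ^ 2 / (1 - a i ^ 2) with hl
  have hl0 : ∀ i, 0 ≤ l i := fun i => div_nonneg (sq_nonneg _) (hd i).le
  -- Normalization turning `1 + q * S₁` into `K₁ * (1 - ∑ p i * z i)` over the first block; likewise
  -- `K₂`.
  set K₁ := 1 + q * ∑ i with c i, l i with hK₁
  set K₂ := 1 + q * ∑ i with ¬ c i, l i with hK₂
  have hK₁0 : 0 < K₁ := by
    have := Finset.sum_nonneg fun i (_ : i ∈ Finset.univ.filter c) => hl0 i
    positivity
  have hK₂0 : 0 < K₂ := by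
    have := Finset.sum_nonneg fun i (_ : i ∈ Finset.univ.filter fun i => ¬ c i) => hl0 i
    positivity
  have hp : ∀ i, 0 ≤ q * l i / (if c i then K₁ else K₂) := fun i => by
    have := hl0 i
    split_ifs <;> positivity
  have hr : ∀ i, 0 < 1 / (1 - a i ^ 2) := fun i => one_div_pos.2 (hd i)
  refine ⟨(q / (K₁ * K₂)) ^ α / Real.Gamma α, ϑ ^ 2 / (K₁ * K₂),
    fun i => q * l i / (if c i then K₁ else K₂), fun i => 1 / (1 - a i ^ 2), by positivity,
    by positivity, hp, hr, fun t ht => ?_⟩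
  have he : ∀ i, 0 < 1 + (1 - a i ^ 2) * t i := fun i => by
    have := hd i
    have := ht i
    positivity
  set s : Fin n → ℝ := fun i => a i ^ 2 * t i / (1 + (1 - a i ^ 2) * t i) with hs
  set z : Fin n → ℝ := fun i => (1 + (1 - a i ^ 2) * t i)⁻¹ with hz
  have hs0 : ∀ i, 0 ≤ s i := fun i => div_nonneg (mul_nonneg (sq_nonneg _) (ht i)) (he i).le
  have hlz : ∀ i, l i * z i = l i - s i := fun i => by
    have := (hd i).ne'
    have := (he i).ne'
    simp only [hl, hz, hs]
    field_simp
    ring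
  rw [det_one_add_blockFactorCorr_mul_diagonal n₁ a ϑ c hc t (fun i => (he i).ne') s fun i => rfl]
  set S₁ := ∑ i with c i, s i with hS₁
  set S₂ := ∑ i with ¬ c i, s i with hS₂
  have hS₁0 : 0 ≤ S₁ := Finset.sum_nonneg fun i _ => hs0 i
  have hS₂0 : 0 ≤ S₂ := Finset.sum_nonneg fun i _ => hs0 i
  have hsum₁ : ∑ i with c i, q * l i / (if c i then K₁ else K₂) * z i = 1 - (1 + q * S₁) / K₁ := by
    have : ∀ i ∈ Finset.univ.filter c, q * l i / (if c i then K₁ else K₂) * z i =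
        q / K₁ * (l i - s i) := fun i hi => by
      rw [if_pos (Finset.mem_filter.1 hi).2, ← hlz]
      ring
    rw [Finset.sum_congr rfl this, ← Finset.mul_sum, Finset.sum_sub_distrib, ← hS₁]
    have : q * ∑ i with c i, l i = K₁ - 1 := by rw [hK₁]; ring
    field_simp
    linarith
  have hsum₂ : ∑ i with ¬ c i, q * l i / (if c i then K₁ else K₂) * z i =
      1 - (1 + q * S₂) / K₂ := by
    have : ∀ i ∈ Finset.univ.filter fun i => ¬ c i, q * l i / (if c i then K₁ else K₂) * z i =
        q / K₂ * (l i - s i) := fun i hi => by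
      rw [if_neg (Finset.mem_filter.1 hi).2, ← hlz]
      ring
    rw [Finset.sum_congr rfl this, ← Finset.mul_sum, Finset.sum_sub_distrib, ← hS₂]
    have : q * ∑ i with ¬ c i, l i = K₂ - 1 := by rw [hK₂]; ring
    field_simp
    linarith
  set D := (1 + S₁) * (1 + S₂) - ϑ ^ 2 * S₁ * S₂ with hD
  have hD0 : 0 < D := by
    have : D = 1 + S₁ + S₂ + q * (S₁ * S₂) := by rw [hD, hq_def]; ring
    rw [this]
    positivity
  -- Since `q = 1 - ϑ ^ 2`, one has `q * D = (1 + q * S₁) * (1 + q * S₂) - ϑ ^ 2`.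
  have hAB : (1 + q * S₁) / K₁ * ((1 + q * S₂) / K₂) - ϑ ^ 2 / (K₁ * K₂) =
      q / (K₁ * K₂) * D := by
    rw [hD, div_mul_div_comm, ← sub_div, div_mul_eq_mul_div]
    congr 1
    rw [show ϑ ^ 2 = 1 - q by rw [hq_def]; ring]
    ring
  have hA : 0 < (1 + q * S₁) / K₁ := by positivity
  have hB : 0 < (1 + q * S₂) / K₂ := by positivity
  have hkD : 0 < q / (K₁ * K₂) * D := by positivity
  have hprod : 0 < ∏ i, (1 + (1 - a i ^ 2) * t i) := Finset.prod_pos fun i _ => he i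
  refine ⟨mul_pos hprod hD0, ?_⟩
  rw [lintegral_exp_neg_sum_gammaMixture c (by positivity) hα (by positivity) hp hr ht
    (z := z) (fun i => by
      have := (hd i).ne'
      have := (he i).ne'
      simp only [hz]
      field_simp) (by rw [hsum₁]; linarith) (by rw [hsum₂]; linarith)
      (by rw [hsum₁, hsum₂, sub_sub_cancel, sub_sub_cancel]; linarith), hsum₁, hsum₂,
    sub_sub_cancel, sub_sub_cancel, hAB]
  congr 1
  have hz' : ∏ i, z i = (∏ i, (1 + (1 - a i ^ 2) * t i))⁻¹ := Finset.prod_inv_distrib _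
  have hk : 0 < q / (K₁ * K₂) := by positivity
  rw [hz', Real.mul_rpow hk.le hD0.le, Real.mul_rpow hprod.le hD0.le, Real.inv_rpow hprod.le,
    Real.rpow_neg hk.le, Real.rpow_neg hprod.le, div_mul_cancel₀ _ hG.ne']
  have := Real.rpow_pos_of_pos hk α
  field_simp

/-! ### The product inequality and the main theorem. -/

lemma jointCdf_eq_jointECDF {n : ℕ} (μ : Measure (Fin n → ℝ)) (x : Fin n → ℝ) :
    jointCdf μ x = jointECDF μ fun i => (x i : EReal) := by
  simp [jointCdf, jointECDF]

lemma partialCdf_eq_jointECDF {n : ℕ} (μ : Measure (Fin n → ℝ)) (I : Finset (Fin n))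
    (x : Fin n → ℝ) :
    partialCdf μ I x = jointECDF μ fun i => if i ∈ I then (x i : EReal) else ⊤ := by
  unfold partialCdf jointECDF
  congr! 4 with ω i
  by_cases h : i ∈ I <;> simp [h]

/-- An MTP₂ joint distribution function satisfies the product inequality for every splitting of the
coordinates. -/
lemma jointCdf_mul_partialCdf_mul_le {n : ℕ} {μ : Measure (Fin n → ℝ)}
    (h : ∀ x y : Fin n → EReal,
      jointECDF μ x * jointECDF μ y ≤ jointECDF μ (x ⊓ y) * jointECDF μ (x ⊔ y))
    {x b : Fin n → ℝ} (hxb : ∀ i, x i ≤ b i) (hb : 0 < jointCdf μ b) (I : Finset (Fin n)) :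
    jointCdf μ b * (partialCdf μ I x * partialCdf μ Iᶜ x) ≤
      jointCdf μ x * (partialCdf μ I b * partialCdf μ Iᶜ b) := by
  have hxb' : ∀ i, (x i : EReal) ≤ b i := fun i => EReal.coe_le_coe_iff.2 (hxb i)
  -- The intermediate point: `x` is the meet of `w` with `(x on I, ⊤ off I)`, and `w` is the meet of
  -- `b` with `(⊤ on I, x off I)`. Multiplying the two MTP₂ inequalities cancels the cdf at `w`.
  set w : Fin n → EReal := fun i => if i ∈ I then (b i : EReal) else x i with hw
  have hnn : ∀ e, 0 ≤ jointECDF μ e := fun e => measureReal_nonneg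
  have h₁ : partialCdf μ I x * jointECDF μ w ≤ jointCdf μ x * partialCdf μ I b := by
    rw [partialCdf_eq_jointECDF, partialCdf_eq_jointECDF, jointCdf_eq_jointECDF]
    convert h (fun i => if i ∈ I then (x i : EReal) else ⊤) w using 3 <;>
    · ext i
      by_cases hi : i ∈ I <;> simp [hw, hi, hxb i]
  have h₂ : jointCdf μ b * partialCdf μ Iᶜ x ≤ jointECDF μ w * partialCdf μ Iᶜ b := by
    rw [partialCdf_eq_jointECDF, partialCdf_eq_jointECDF, jointCdf_eq_jointECDF]
    convert h (fun i => (b i : EReal)) (fun i => if i ∈ Iᶜ then (x i : EReal) else ⊤) using 3 <;>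
    · ext i
      by_cases hi : i ∈ I <;> simp [hw, hi, hxb i]
  have hP : ∀ (J : Finset (Fin n)) (y : Fin n → ℝ), 0 ≤ partialCdf μ J y :=
    fun J y => measureReal_nonneg
  -- The cdf at `w` can vanish, as `x` may have nonpositive coordinates off `I`; then the marginal
  -- of `x` on `Iᶜ` vanishes too.
  rcases (hnn w).eq_or_lt with hw0 | hw0
  · rw [← hw0, zero_mul] at h₂
    have : partialCdf μ Iᶜ x = 0 := le_antisymm (nonpos_of_mul_nonpos_right h₂ hb) (hP _ _)
    rw [this, mul_zero, mul_zero]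
    exact mul_nonneg measureReal_nonneg (mul_nonneg (hP _ _) (hP _ _))
  · refine le_of_mul_le_mul_right ?_ hw0
    have := mul_le_mul h₁ h₂ (mul_nonneg hb.le (hP _ _)) (mul_nonneg measureReal_nonneg (hP _ _))
    linarith

theorem mainTheorem7 (n n₁ : ℕ) (hn₁ : 1 < n₁) (hn : n₁ + 1 < n)
    (a : Fin n → ℝ) (ha : ∀ i, |a i| < 1) (ϑ : ℝ) (hϑ : |ϑ| < 1) (α : ℝ) (hα : 0 < α) :
    (∃! μ : Measure (Fin n → ℝ), IsMultivariateGamma α (blockFactorCorr n₁ a ϑ) μ) ∧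
    ∀ μ : Measure (Fin n → ℝ), IsMultivariateGamma α (blockFactorCorr n₁ a ϑ) μ →
      IsMTP2On (Set.univ.pi fun _ => Set.Ioi (0 : ℝ)) (jointCdf μ) ∧
      ∀ x b : Fin n → ℝ, (∀ i, 0 < b i) → (∀ i, x i ≤ b i) →
        ∀ I : Finset (Fin n), I.Nonempty →
          partialCdf μ I x * partialCdf μ Iᶜ x / (partialCdf μ I b * partialCdf μ Iᶜ b)
              ≤ jointCdf μ x / jointCdf μ b ∧
          ((∀ i, 0 < x i) →
            jointCdf μ b / (partialCdf μ I b * partialCdf μ Iᶜ b)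
              ≤ jointCdf μ x / (partialCdf μ I x * partialCdf μ Iᶜ x)) := by
  classical
  set c : Fin n → Prop := fun i => (i : ℕ) < n₁
  obtain ⟨C, θ, p, r, hC, hθ, hp, hr, hL⟩ :=
    exists_gammaMixture_laplace n₁ a ha ϑ hϑ hα c fun _ => Iff.rfl
  set μ₀ := gammaMixture c C α θ p r with hμ₀
  -- The total mass is the Laplace transform at `t = 0`, where the determinant is 1.
  have hprob : IsProbabilityMeasure μ₀ := ⟨by simpa using (hL 0 fun _ => le_rfl).2⟩
  have hgamma : IsMultivariateGamma α (blockFactorCorr n₁ a ϑ) μ₀ := by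
    refine ⟨hprob, ae_nonneg_gammaMixture c hα hr, fun t ht => ?_⟩
    obtain ⟨hdet, hLt⟩ := hL t ht
    rw [integral_eq_lintegral_of_nonneg_ae (ae_of_all _ fun _ => (Real.exp_pos _).le)
      (Continuous.aestronglyMeasurable (by fun_prop)), hLt, ENNReal.toReal_ofReal (by positivity)]
  have huniq : ∀ μ, IsMultivariateGamma α (blockFactorCorr n₁ a ϑ) μ → μ = μ₀ := fun μ hμ => by
    have := hμ.isProbabilityMeasure
    exact ext_of_laplace_of_ae_nonneg hμ.ae_nonneg hgamma.ae_nonneg fun t ht => by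
      rw [hμ.laplace t ht, hgamma.laplace t ht]
  refine ⟨⟨μ₀, hgamma, huniq⟩, fun μ hμ => ?_⟩
  rw [huniq μ hμ]
  have hmtp := jointECDF_gammaMixture_mul_le c hC.le hα hθ hp hr
  have hpos : ∀ {e : Fin n → EReal}, (∀ i, 0 < e i) → 0 < jointECDF μ₀ e :=
    fun he => jointECDF_gammaMixture_pos c hC hα hθ hp hr he
  have hjpos : ∀ {y : Fin n → ℝ}, (∀ i, 0 < y i) → 0 < jointCdf μ₀ y := fun hy => by
    rw [jointCdf_eq_jointECDF]
    exact hpos fun i => EReal.coe_pos.2 (hy i)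
  have hppos : ∀ {y : Fin n → ℝ} (J : Finset (Fin n)), (∀ i, 0 < y i) → 0 < partialCdf μ₀ J y :=
    fun J hy => by
      rw [partialCdf_eq_jointECDF]
      refine hpos fun i => ?_
      split_ifs
      · exact EReal.coe_pos.2 (hy i)
      · exact EReal.zero_lt_top
  refine ⟨⟨fun x hx => hjpos fun i => hx i trivial, fun x _ y _ => ?_⟩, fun x b hb hxb I _ => ?_⟩
  · simp only [jointCdf_eq_jointECDF]
    rw [mul_comm (jointECDF μ₀ fun i => ((x ⊔ y) i : EReal))]
    convert hmtp (fun i => (x i : EReal)) (fun i => (y i : EReal)) using 3 <;> ext i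
    · exact EReal.coe_strictMono.monotone.map_inf (x i) (y i)
    · exact EReal.coe_strictMono.monotone.map_sup (x i) (y i)
  · have key := jointCdf_mul_partialCdf_mul_le hmtp hxb (hjpos hb) I
    have hPb := mul_pos (hppos I hb) (hppos Iᶜ hb)
    refine ⟨?_, fun hx => ?_⟩
    · rw [div_le_div_iff₀ hPb (hjpos hb)]
      linarith
    · rw [div_le_div_iff₀ hPb (mul_pos (hppos I hx) (hppos Iᶜ hx))]
      exact key

end
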